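/- Let $n\ge 0$ and let $f:\mathbb{R}^n\to\mathbb{R}^n$ be monotone for the coordinatewise order ($x\le y\Rightarrow f(x)\le f(y)$), additively homogeneous ($f(\lambda+x)=\lambda+f(x)$ for all $\lambda\in\mathbb{R}$ and $x\in\mathbb{R}^n$, where the scalar $\lambda$ is added to every coordinate) and convex (each coordinate function is convex). An eigenvector of $f$ is a vector $v\in\mathbb{R}^n$ with $f(v)=\lambda+v$ for some $\lambda\in\mathbb{R}$. For $v\in\mathbb{R}^n$ put $$\partial f(v)=\{P\in\mathbb{R}^{n\times n}: f(y)-f(v)\ge P(y-v)\ \text{for all } y\in\mathbb{R}^n\}.$$ The graph $\mathscr{G}(P)$ of a matrix $P$ has nodes $1,\dots,n$ and an arc $i\to j$ whenever $P_{ij}\ne 0$. The classes of a directed graph are the equivalence classes of its nodes for mutual accessibility by directed paths (every node has access to itself), its strongly connected components are its restrictions to its classes, and a class is final if no node of it has access to a node outside it. The final graph of $P$ is the union of the restrictions of $\mathscr{G}(P)$ to its final classes. For an eigenvector $v$ of $f$, the critical graph $\mathscr{G}^{\rm c}(f)$ of $f$ is the union of the final graphs of the matrices $P\in\partial f(v)$,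 and the cyclicity $\mathsf{c}(f)$ is the least common multiple, over the strongly connected components of $\mathscr{G}^{\rm c}(f)$, of the greatest common divisor of the lengths of the circuits of the component (with $\mathsf{c}(f)=1$ if the graph is empty, that is, if $n=0$). **Theorem.** Suppose that $f$ has a periodic orbit, that is, $x\in\mathbb{R}^n$ satisfies $f^k(x)=x$ for some $k\ge 1$. Then $f$ has an eigenvector, and, whichever eigenvector $v$ is used to define $\mathscr{G}^{\rm c}(f)$, the length of the orbit of $x$ (the least $k\ge1$ with $f^k(x)=x$) divides $\mathsf{c}(f)$. -/

import Mathlib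

namespace ConvexSpectral

/-- A directed graph with node set `nodes ⊆ ι` and arcs between its nodes; loops are allowed. -/
structure DiGraph (ι : Type*) where
  nodes : Set ι
  Arc : ι → ι → Prop
  left_mem : ∀ {i j}, Arc i j → i ∈ nodes
  right_mem : ∀ {i j}, Arc i j → j ∈ nodes

namespace DiGraph

variable {ι : Type*}

/-- `i` has access to `j`: there is a directed path from `i` to `j`, or `i = j`. -/
def HasAccess (G : DiGraph ι) (i j : ι) : Prop :=
  Relation.ReflTransGen G.Arc i j

/-- The classes of `G`: equivalence classes of nodes for mutual access. -/
def IsClass (G : DiGraph ι) (C : Set ι) : Prop :=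
  ∃ i ∈ G.nodes, C = {j | j ∈ G.nodes ∧ G.HasAccess i j ∧ G.HasAccess j i}

/-- A class is final if none of its nodes has access to a node outside of it. -/
def IsFinalClass (G : DiGraph ι) (C : Set ι) : Prop :=
  G.IsClass C ∧ ∀ i ∈ C, ∀ j ∈ G.nodes, G.HasAccess i j → j ∈ C

/-- The subgraph of `G` with node set `C` (intersected with the nodes of `G`) and all the arcs
of `G` between nodes of `C`. For a class `C` this is a strongly connected component of `G`. -/
def restrict (G : DiGraph ι) (C : Set ι) : DiGraph ι where
  nodes := G.nodes ∩ C
  Arc i j := G.Arc i j ∧ i ∈ C ∧ j ∈ C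
  left_mem h := ⟨G.left_mem h.1, h.2.1⟩
  right_mem h := ⟨G.right_mem h.1, h.2.2⟩

/-- The union of a family of graphs. -/
def iUnion {κ : Sort*} (G : κ → DiGraph ι) : DiGraph ι where
  nodes := {i | ∃ k, i ∈ (G k).nodes}
  Arc i j := ∃ k, (G k).Arc i j
  left_mem h := h.imp fun k hk => (G k).left_mem hk
  right_mem h := h.imp fun k hk => (G k).right_mem hk

/-- `k ≥ 1` is the length of a circuit `p 0 → p 1 → ⋯ → p k = p 0` of `G`. -/
def IsCircuitLength (G : DiGraph ι) (k : ℕ) : Prop :=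
  0 < k ∧ ∃ p : ℕ → ι, (∀ t < k, G.Arc (p t) (p (t + 1))) ∧ p k = p 0

/-- The gcd of the lengths of the circuits of `G`: the cyclicity of a strongly connected graph. -/
noncomputable def circuitGcd (G : DiGraph ι) : ℕ :=
  Nat.setGcd {k | G.IsCircuitLength k}

/-- The cyclicity of a graph: the lcm, over its classes `C`, of the cyclicity of the strongly
connected component with node set `C`; it is `1` for the empty graph. -/
noncomputable def cyclicity [Finite ι] (G : DiGraph ι) : ℕ :=
  (Set.toFinite {C : Set ι | G.IsClass C}).toFinset.lcm fun C => (G.restrict C).circuitGcd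

end DiGraph

/-- The graph of a matrix: an arc `i → j` for each nonzero entry `P i j`. -/
def matrixGraph {n : ℕ} (P : Matrix (Fin n) (Fin n) ℝ) : DiGraph (Fin n) where
  nodes := Set.univ
  Arc i j := P i j ≠ 0
  left_mem _ := Set.mem_univ _
  right_mem _ := Set.mem_univ _

/-- The final graph of a matrix: the union, over its final classes `F`, of the restriction of the
graph of the matrix to `F`. -/
def finalGraph {n : ℕ} (P : Matrix (Fin n) (Fin n) ℝ) : DiGraph (Fin n) :=
  DiGraph.iUnion fun F : {F : Set (Fin n) // (matrixGraph P).IsFinalClass F} =>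
    (matrixGraph P).restrict F

/-- Additive homogeneity: `f (a + x) = a + f x`, the scalar `a` being added to every coordinate. -/
def IsHomogeneous {n : ℕ} (f : (Fin n → ℝ) → (Fin n → ℝ)) : Prop :=
  ∀ (a : ℝ) (x : Fin n → ℝ), f (fun i => a + x i) = fun i => a + f x i

/-- `f` is convex if each of its coordinates is a convex function. -/
def IsConvexMap {n : ℕ} (f : (Fin n → ℝ) → (Fin n → ℝ)) : Prop :=
  ∀ i, ConvexOn ℝ Set.univ fun x => f x i

/-- `v` is an (additive) eigenvector of `f`: `f v = a + v` for some real eigenvalue `a`. -/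
def IsEigenvector {n : ℕ} (f : (Fin n → ℝ) → (Fin n → ℝ)) (v : Fin n → ℝ) : Prop :=
  ∃ a : ℝ, f v = fun i => a + v i

/-- The subdifferential of `f` at `v`. -/
def subdifferential {n : ℕ} (f : (Fin n → ℝ) → (Fin n → ℝ)) (v : Fin n → ℝ) :
    Set (Matrix (Fin n) (Fin n) ℝ) :=
  {P | ∀ x, Matrix.mulVec P (x - v) ≤ f x - f v}

/-- The critical graph of `f`, computed at the eigenvector `v`: the union of the final graphs of
the matrices in the subdifferential of `f` at `v`. -/
def criticalGraph {n : ℕ} (f : (Fin n → ℝ) → (Fin n → ℝ)) (v : Fin n → ℝ) : DiGraph (Fin n) :=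
  DiGraph.iUnion fun P : {P : Matrix (Fin n) (Fin n) ℝ // P ∈ subdifferential f v} =>
    finalGraph P.1

end ConvexSpectral

namespace ConvexSpectral

open Relation

/-! ### Convex functions have subgradients -/

/-! Traverse the orbit backwards, as a periodic sequence with `f (b (t + 1)) = b t`. Every
eigenvector `v` is a fixed point, and each `P ∈ ∂f(v)` is a stochastic matrix with `P (b (t + 1) -
v) ≤ b t - v`. By periodicity and the minimum principle, `b - v` is transported unchanged along the
arcs of the final classes of `P` (`eq_of_superharmonic`). Every circuit length is thus a period of
`b` on its component, and the cyclicity is a period at all critical nodes.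

The critical nodes determine the whole backward orbit (`le_of_eq_on_criticalGraph_nodes`). The
minimum set of the difference of two such orbits is closed under the arcs of subgradients taken
along one of them. A second minimization shows that some of these rows are also subgradients at `v`,
so the minimum is reached at a critical node, where the difference is zero. Comparing `b` with its
shift by the cyclicity concludes. -/

theorem exists_subgradient {E : Type*} [NormedAddCommGroup E] [NormedSpace ℝ E]
    [FiniteDimensional ℝ E] {φ : E → ℝ} (hφ : ConvexOn ℝ Set.univ φ) (v : E) :
    ∃ l : E →ₗ[ℝ] ℝ, ∀ y, l (y - v) ≤ φ y - φ v := by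
  have hcont : Continuous φ := hφ.locallyLipschitz.continuous
  have hopen : IsOpen {p : E × ℝ | p.1 ∈ Set.univ ∧ φ p.1 < p.2} := by
    simpa using isOpen_lt (hcont.comp continuous_fst) continuous_snd
  -- Separate `(v, φ v)` from the open strict epigraph; the vertical coefficient `L (0, 1)` is
  -- positive, so the hyperplane is the graph of an affine minorant.
  obtain ⟨L, hL⟩ := geometric_hahn_banach_point_open (x := (v, φ v))
    hφ.convex_strict_epigraph hopen (by simp)
  have hsplit : ∀ y r, L (y, r) = L (y, 0) + r * L (0, 1) := fun y r => by
    have h : ((y, r) : E × ℝ) = (y, 0) + r • (0, 1) := by simp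
    rw [h, map_add, map_smul, smul_eq_mul]
  have hc : 0 < L (0, 1) := by
    have h := hL (v, φ v + 1) (by simp)
    rw [hsplit, hsplit v (φ v + 1)] at h
    linarith
  refine ⟨-((L (0, 1))⁻¹ • (L.toLinearMap ∘ₗ LinearMap.inl ℝ E ℝ)), fun y => ?_⟩
  have hle : L (v, φ v) ≤ L (y, φ y) := by
    refine le_of_forall_pos_lt_add fun ε hε => ?_
    have h := hL (y, φ y + ε / L (0, 1)) (by simpa using div_pos hε hc)
    rw [hsplit y (φ y + _), add_mul, div_mul_cancel₀ _ hc.ne', ← add_assoc, ← hsplit] at h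
    exact h
  rw [hsplit, hsplit y] at hle
  have hsub : L (y - v, 0) = L (y, 0) - L (v, 0) := by
    rw [← map_sub]; simp
  simp only [LinearMap.neg_apply, LinearMap.smul_apply, LinearMap.comp_apply,
    LinearMap.inl_apply, ContinuousLinearMap.coe_coe, smul_eq_mul, hsub]
  rw [neg_le_iff_add_nonneg, ← mul_le_mul_iff_right₀ hc]
  field_simp
  linarith

/-! ### Subgradients of `f` are stochastic matrices -/

section Subdifferential

variable {n : ℕ} {f : (Fin n → ℝ) → (Fin n → ℝ)}

theorem mem_subdifferential_iff {v : Fin n → ℝ} {P : Matrix (Fin n) (Fin n) ℝ} :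
    P ∈ subdifferential f v ↔ ∀ i y, ∑ j, P i j * (y j - v j) ≤ f y i - f v i := by
  rw [forall_comm]
  rfl

theorem subdifferential_nonempty (hconv : IsConvexMap f) (v : Fin n → ℝ) :
    (subdifferential f v).Nonempty := by
  choose l hl using fun i => exists_subgradient (hconv i) v
  refine ⟨LinearMap.toMatrix' (LinearMap.pi l), fun y => ?_⟩
  rw [LinearMap.toMatrix'_mulVec]
  exact fun i => hl i y

theorem entry_nonneg (hmono : Monotone f) {v : Fin n → ℝ} {P : Matrix (Fin n) (Fin n) ℝ}
    (hP : P ∈ subdifferential f v) (i j : Fin n) : 0 ≤ P i j := by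
  have h := mem_subdifferential_iff.1 hP i (v - Pi.single j 1)
  have hle : f (v - Pi.single j 1) i ≤ f v i :=
    hmono (sub_le_self v (Pi.single_nonneg.2 zero_le_one)) i
  simp [Pi.single_apply] at h
  linarith

theorem row_sum_eq_one (hhom : IsHomogeneous f) {v : Fin n → ℝ} {P : Matrix (Fin n) (Fin n) ℝ}
    (hP : P ∈ subdifferential f v) (i : Fin n) : ∑ j, P i j = 1 := by
  have h (a : ℝ) : (∑ j, P i j) * a ≤ a := by
    have := mem_subdifferential_iff.1 hP i (fun k => a + v k)
    rw [hhom] at this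
    simpa [Finset.sum_mul] using this
  linarith [h 1, h (-1)]

end Subdifferential

/-! ### The minimum principle -/

/-- A weighted mean of values at least `a` cannot be at most `a` unless every value of positive
weight equals `a`. -/
theorem min_principle {ι : Type*} [Fintype ι] {p u : ι → ℝ} {a : ℝ} (hp : ∀ j, 0 ≤ p j)
    (hsum : ∑ j, p j = 1) (hle : ∑ j, p j * u j ≤ a) (hmin : ∀ j, p j ≠ 0 → a ≤ u j) :
    (∀ j, p j ≠ 0 → u j = a) ∧ ∑ j, p j * u j = a := by
  have hterm : ∀ j ∈ Finset.univ, 0 ≤ p j * (u j - a) := fun j _ => by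
    by_cases h : p j = 0
    · simp [h]
    · exact mul_nonneg (hp j) (sub_nonneg.2 (hmin j h))
  have hexp : ∑ j, p j * (u j - a) = ∑ j, p j * u j - a := by
    simp_rw [mul_sub, Finset.sum_sub_distrib, ← Finset.sum_mul, hsum, one_mul]
  have hzero : ∑ j, p j * (u j - a) = 0 :=
    le_antisymm (by linarith) (Finset.sum_nonneg hterm)
  refine ⟨fun j hj => ?_, by linarith⟩
  have h := (Finset.sum_eq_zero_iff_of_nonneg hterm).1 hzero j (Finset.mem_univ j)
  exact sub_eq_zero.1 ((mul_eq_zero.1 h).resolve_left hj)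

/-- A real function with finite range attains its minimum on every nonempty set. -/
theorem exists_argmin {α : Type*} {u : α → ℝ} (hu : (Set.range u).Finite) {S : Set α}
    (hS : S.Nonempty) : ∃ a ∈ S, ∀ b ∈ S, u a ≤ u b := by
  obtain ⟨_, ⟨a, ha, rfl⟩, h⟩ := Set.exists_min_image (u '' S) id
    (hu.subset (Set.image_subset_range u S)) (hS.image u)
  exact ⟨a, ha, fun b hb => h _ ⟨b, hb, rfl⟩⟩

/-! ### Graphs -/

namespace DiGraph

variable {ι : Type*} {G : DiGraph ι}

theorem IsClass.hasAccess {C : Set ι} (hC : G.IsClass C) {i j : ι} (hi : i ∈ C) (hj : j ∈ C) :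
    G.HasAccess i j := by
  obtain ⟨k, -, rfl⟩ := hC
  exact hi.2.2.trans hj.2.1

/-- A nonempty set of nodes which is closed under the arcs contains a final class. -/
theorem exists_isFinalClass_subset [Finite ι] {S : Set ι} (hS : S.Nonempty) (hnodes : S ⊆ G.nodes)
    (hclosed : ∀ i ∈ S, ∀ j, G.Arc i j → j ∈ S) : ∃ F ⊆ S, F.Nonempty ∧ G.IsFinalClass F := by
  have hacc : ∀ {i j}, i ∈ S → G.HasAccess i j → j ∈ S := fun hi hij => by
    induction hij with
    | refl => exact hi
    | tail _ h ih => exact hclosed _ ih _ h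
  -- A node with the fewest accessible nodes is accessible from everything it reaches.
  obtain ⟨i, hi, hmin⟩ := Set.exists_min_image S (fun i => {j | G.HasAccess i j}.ncard)
    (Set.toFinite S) hS
  have hback : ∀ j, G.HasAccess i j → G.HasAccess j i := fun j hij => by
    have hsub : {k | G.HasAccess j k} ⊆ {k | G.HasAccess i k} := fun k hk => hij.trans hk
    have heq := Set.eq_of_subset_of_ncard_le hsub (hmin j (hacc hi hij)) (Set.toFinite _)
    exact heq.symm.subset (ReflTransGen.refl : G.HasAccess i i)
  refine ⟨{j | j ∈ G.nodes ∧ G.HasAccess i j ∧ G.HasAccess j i}, fun j hj => hacc hi hj.2.1,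
    ⟨i, hnodes hi, .refl, .refl⟩, ⟨i, hnodes hi, rfl⟩, fun j hj k hk hjk => ?_⟩
  exact ⟨hk, hj.2.1.trans hjk, hback k (hj.2.1.trans hjk)⟩

/-- The arcs of the time-expanded graph: time increases by one along an arc. -/
def TimeArc (G : DiGraph ι) (a b : ℕ × ι) : Prop :=
  b.1 = a.1 + 1 ∧ G.Arc a.2 b.2

theorem HasAccess.exists_timeArc {i j : ι} (h : G.HasAccess i j) :
    ∃ l, ∀ t, ReflTransGen G.TimeArc (t, i) (t + l, j) := by
  induction h with
  | refl => exact ⟨0, fun t => .refl⟩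
  | tail _ h ih =>
    obtain ⟨l, hl⟩ := ih
    exact ⟨l + 1, fun t => (hl t).tail ⟨rfl, h⟩⟩

theorem TimeArc.exists_shift {a b : ℕ × ι} (h : ReflTransGen G.TimeArc a b) :
    G.HasAccess a.2 b.2 ∧ ∃ l, b.1 = a.1 + l ∧
      ∀ t, ReflTransGen G.TimeArc (t, a.2) (t + l, b.2) := by
  induction h with
  | refl => exact ⟨.refl, 0, rfl, fun t => .refl⟩
  | tail _ h ih =>
    obtain ⟨hacc, l, hl, hw⟩ := ih
    exact ⟨hacc.tail h.2, l + 1, by rw [h.1, hl, add_assoc], fun t =>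
      (hw t).tail ⟨rfl, h.2⟩⟩

theorem timeArc_iterate {i : ι} {l : ℕ} (h : ∀ t, ReflTransGen G.TimeArc (t, i) (t + l, i))
    (m t : ℕ) : ReflTransGen G.TimeArc (t, i) (t + m * l, i) := by
  induction m with
  | zero => simpa using (ReflTransGen.refl : ReflTransGen G.TimeArc (t, i) (t, i))
  | succ m ih =>
    rw [add_mul, one_mul, ← add_assoc]
    exact ih.trans (h _)

end DiGraph

/-! ### Periodic superharmonic functions -/

section Periodic

variable {n : ℕ}

theorem finite_range_of_periodic {α : Type*} {b : ℕ → α} {p : ℕ} (hp : 0 < p)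
    (hb : Function.Periodic b p) : (Set.range b).Finite := by
  refine ((Set.finite_Iio p).image b).subset ?_
  rintro _ ⟨t, rfl⟩
  exact ⟨t % p, Nat.mod_lt t hp, hb.map_mod_nat t⟩

/-- A periodic superharmonic function is constant along the arcs of a final class. -/
theorem eq_of_superharmonic {P : Matrix (Fin n) (Fin n) ℝ} (hP : ∀ i j, 0 ≤ P i j)
    (hsum : ∀ i, ∑ j, P i j = 1) {b : ℕ → Fin n → ℝ} {p : ℕ} (hp : 0 < p)
    (hb : Function.Periodic b p) (hle : ∀ t i, ∑ j, P i j * b (t + 1) j ≤ b t i)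
    {F : Set (Fin n)} (hF : (matrixGraph P).IsFinalClass F) {i j : Fin n} (hi : i ∈ F)
    (hij : P i j ≠ 0) (t : ℕ) : b t i = b (t + 1) j := by
  set u : ℕ × Fin n → ℝ := fun a => b a.1 a.2 with hu
  have hfin : (Set.range u).Finite := by
    refine ((finite_range_of_periodic hp hb).prod (Set.finite_univ (α := Fin n))).image
      (fun a => a.1 a.2) |>.subset ?_
    rintro _ ⟨a, rfl⟩
    exact ⟨(b a.1, a.2), ⟨⟨a.1, rfl⟩, trivial⟩, rfl⟩
  obtain ⟨⟨s, k⟩, hsk, hmin⟩ := exists_argmin hfin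
    (S := {a | ReflTransGen (matrixGraph P).TimeArc (t, i) a}) ⟨(t, i), .refl⟩
  have hconst : ∀ c, ReflTransGen (matrixGraph P).TimeArc (s, k) c → u c = u (s, k) := by
    intro c hc
    induction hc with
    | refl => rfl
    | @tail c d hc hd ih =>
      obtain ⟨d1, d2⟩ := d
      obtain ⟨rfl, hd2⟩ := hd
      rw [← ih]
      refine (min_principle (hP c.2) (hsum c.2) (hle c.1 c.2) fun j hj => ?_).1 d2 hd2
      have := hmin (c.1 + 1, j) (ReflTransGen.tail (hsk.trans hc) ⟨rfl, hj⟩)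
      rw [← ih] at this
      exact this
  obtain ⟨hik, l, hl, hw⟩ := DiGraph.TimeArc.exists_shift hsk
  have hkF : k ∈ F := hF.2 i hi k trivial hik
  obtain ⟨l', hw'⟩ := (hF.1.hasAccess hkF hi).exists_timeArc
  have hloop : ∀ t, ReflTransGen (matrixGraph P).TimeArc (t, i) (t + (l + l'), i) := fun t => by
    rw [← add_assoc]
    exact (hw t).trans (hw' _)
  -- From the minimizer the walk returns to `i`; `p` rounds in all make the elapsed time a multiple
  -- of `p`, so the value there is `b t i`.
  have hback : ReflTransGen (matrixGraph P).TimeArc (s, k) (t + p * (l + l'), i) := by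
    have hsplit : t + p * (l + l') = s + l' + (p - 1) * (l + l') := by
      obtain ⟨q, rfl⟩ := Nat.exists_eq_succ_of_ne_zero hp.ne'
      simp only at hl
      rw [hl, Nat.succ_sub_one, Nat.succ_eq_add_one]
      ring
    rw [hsplit]
    exact (hw' s).trans (DiGraph.timeArc_iterate hloop _ _)
  have hti : b t i = u (s, k) := by
    rw [← hconst _ hback, hu, mul_comm]
    exact congrFun (hb.nat_mul (l + l') t).symm i
  have htj := hconst _ (hback.tail (c := (t + p * (l + l') + 1, j)) ⟨rfl, hij⟩)
  rw [hti, ← htj, hu, add_right_comm, mul_comm]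
  exact congrFun (hb.nat_mul (l + l') (t + 1)) j

end Periodic

/-! ### Backward orbits and the critical graph -/

section Orbits

variable {n : ℕ} {f : (Fin n → ℝ) → (Fin n → ℝ)}

/-- Along a backward periodic orbit `b` of `f`, the arcs of the critical graph at the fixed point
`v` transport the values of `b - v`. -/
theorem eq_of_criticalGraph_arc (hmono : Monotone f) (hhom : IsHomogeneous f) {v : Fin n → ℝ}
    (hv : f v = v) {b : ℕ → Fin n → ℝ} (hb : ∀ t, f (b (t + 1)) = b t) {p : ℕ} (hp : 0 < p)
    (hper : Function.Periodic b p) {i j : Fin n} (hij : (criticalGraph f v).Arc i j) (t : ℕ) :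
    b t i - v i = b (t + 1) j - v j := by
  obtain ⟨⟨P, hP⟩, ⟨F, hF⟩, hPij, hi, -⟩ := hij
  refine eq_of_superharmonic (entry_nonneg hmono hP) (row_sum_eq_one hhom hP) hp
    (b := fun t => b t - v) (fun t => by simp only [hper t]) (fun t i => ?_) hF hi hPij t
  have := mem_subdifferential_iff.1 hP i (b (t + 1))
  rwa [hb, hv] at this

theorem mem_criticalGraph_nodes {v : Fin n → ℝ} {P : Matrix (Fin n) (Fin n) ℝ}
    (hP : P ∈ subdifferential f v) {F : Set (Fin n)} (hF : (matrixGraph P).IsFinalClass F)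
    {i : Fin n} (hi : i ∈ F) : i ∈ (criticalGraph f v).nodes :=
  ⟨⟨P, hP⟩, ⟨F, hF⟩, trivial, hi⟩

/-- Two backward orbits with finitely many values which agree on the critical nodes are
comparable. -/
theorem le_of_eq_on_criticalGraph_nodes (hconv : IsConvexMap f) (hmono : Monotone f)
    (hhom : IsHomogeneous f) {v : Fin n → ℝ} (hv : f v = v) {b c : ℕ → Fin n → ℝ}
    (hb : ∀ t, f (b (t + 1)) = b t) (hc : ∀ t, f (c (t + 1)) = c t)
    (hbfin : (Set.range b).Finite) (hcfin : (Set.range c).Finite)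
    (heq : ∀ i ∈ (criticalGraph f v).nodes, ∀ t, b t i = c t i) (t : ℕ) : b t ≤ c t := by
  intro i
  choose Q hQ using subdifferential_nonempty hconv
  have hQb := fun t => hQ (b t)
  set w : ℕ × Fin n → ℝ := fun a => c a.1 a.2 - b a.1 a.2 with hw
  set g : ℕ × Fin n → ℝ := fun a => v a.2 - b a.1 a.2 with hg
  have hwfin : (Set.range w).Finite := by
    refine ((hbfin.prod hcfin).prod (Set.finite_univ (α := Fin n))).image
      (fun a => a.1.2 a.2 - a.1.1 a.2) |>.subset ?_
    rintro _ ⟨a, rfl⟩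
    exact ⟨((b a.1, c a.1), a.2), ⟨⟨⟨a.1, rfl⟩, ⟨a.1, rfl⟩⟩, trivial⟩, rfl⟩
  have hgfin : (Set.range g).Finite := by
    refine (hbfin.prod (Set.finite_univ (α := Fin n))).image
      (fun a => v a.2 - a.1 a.2) |>.subset ?_
    rintro _ ⟨a, rfl⟩
    exact ⟨(b a.1, a.2), ⟨⟨a.1, rfl⟩, trivial⟩, rfl⟩
  have hwQ (t i) : ∑ j, Q (b (t + 1)) i j * w (t + 1, j) ≤ w (t, i) := by
    have := mem_subdifferential_iff.1 (hQb (t + 1)) i (c (t + 1))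
    rwa [hb, hc] at this
  have hgQ (t i) : ∑ j, Q (b (t + 1)) i j * g (t + 1, j) ≤ g (t, i) := by
    have := mem_subdifferential_iff.1 (hQb (t + 1)) i v
    rwa [hb, hv] at this
  obtain ⟨a₀, -, ha₀⟩ := exists_argmin hwfin (S := Set.univ) ⟨(t, i), trivial⟩
  -- Minimizing `g` among the minimizers of `w` forces equality in `hgQ` on `H`; this equality is
  -- what moves subgradients from `b (t + 1)` to `v`.
  obtain ⟨a₁, ha₁, hmin⟩ := exists_argmin hgfin (S := {a | w a = w a₀}) ⟨a₀, rfl⟩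
  set H : Set (ℕ × Fin n) := {a | w a = w a₀ ∧ g a = g a₁} with hH
  have hstep : ∀ t i, (t, i) ∈ H → (∀ j, Q (b (t + 1)) i j ≠ 0 → (t + 1, j) ∈ H) ∧
      ∑ j, Q (b (t + 1)) i j * g (t + 1, j) = g (t, i) := by
    rintro t i ⟨h₀, h₁⟩
    have hnn := entry_nonneg hmono (hQb (t + 1)) i
    have hsum := row_sum_eq_one hhom (hQb (t + 1)) i
    have hwj := (min_principle hnn hsum (hwQ t i) fun j _ => h₀.trans_le (ha₀ _ trivial)).1
    have hgj := min_principle hnn hsum (hgQ t i) fun j hj =>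
      h₁.trans_le (hmin _ ((hwj j hj).trans h₀))
    exact ⟨fun j hj => ⟨(hwj j hj).trans h₀, (hgj.1 j hj).trans h₁⟩, hgj.2⟩
  -- A node may occur in `H` at several times; any one of them supplies its row, since `∂f(v)` is
  -- defined row by row.
  let P : Matrix (Fin n) (Fin n) ℝ := fun i =>
    open Classical in if h : ∃ t, (t, i) ∈ H then Q (b (h.choose + 1)) i else Q v i
  have hProw (i) (h : ∃ t, (t, i) ∈ H) : P i = Q (b (h.choose + 1)) i := dif_pos h
  have hP : P ∈ subdifferential f v := by
    refine mem_subdifferential_iff.2 fun i y => ?_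
    by_cases h : ∃ t, (t, i) ∈ H
    · rw [hProw i h]
      have hy := mem_subdifferential_iff.1 (hQb (h.choose + 1)) i y
      have hgi := (hstep _ _ h.choose_spec).2
      have hsub : ∑ j, Q (b (h.choose + 1)) i j * (y j - v j) =
          ∑ j, Q (b (h.choose + 1)) i j * (y j - b (h.choose + 1) j) -
            ∑ j, Q (b (h.choose + 1)) i j * g (h.choose + 1, j) := by
        rw [← Finset.sum_sub_distrib]
        exact Finset.sum_congr rfl fun j _ => by simp only [hg]; ring
      rw [hb] at hy
      rw [hsub, hgi, hv]
      simp only [hg]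
      linarith
    · have hPi : P i = Q v i := dif_neg h
      rw [hPi]
      exact mem_subdifferential_iff.1 (hQ v) i y
  obtain ⟨F, hFS, ⟨k, hk⟩, hF⟩ := DiGraph.exists_isFinalClass_subset (G := matrixGraph P)
    (S := {i | ∃ t, (t, i) ∈ H}) ⟨a₁.2, a₁.1, ha₁, rfl⟩ (fun _ _ => trivial)
    (fun i hi j (hij : P i j ≠ 0) => ⟨_, (hstep _ _ hi.choose_spec).1 j (hProw i hi ▸ hij)⟩)
  obtain ⟨s, hs, -⟩ := hFS hk
  have hzero : w (s, k) = 0 :=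
    sub_eq_zero.2 (heq k (mem_criticalGraph_nodes hP hF hk) s).symm
  have := ha₀ (t, i) trivial
  rw [← hs, hzero] at this
  exact sub_nonneg.1 this

theorem iterate_add_const (hhom : IsHomogeneous f) (a : ℝ) (y : Fin n → ℝ) (m : ℕ) :
    f^[m] (fun i => a + y i) = fun i => a + f^[m] y i := by
  induction m generalizing y with
  | zero => rfl
  | succ m ih => rw [Function.iterate_succ_apply, hhom, ih, Function.iterate_succ_apply]

theorem iterate_eigenvector (hhom : IsHomogeneous f) {v : Fin n → ℝ} {a : ℝ}
    (hv : f v = fun i => a + v i) (m : ℕ) : f^[m] v = fun i => m * a + v i := by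
  induction m with
  | zero => simp
  | succ m ih =>
    rw [Function.iterate_succ_apply, hv, iterate_add_const hhom, ih]
    ext i
    push_cast
    ring

/-- If `f` has a periodic point, then all its eigenvectors are fixed points. -/
theorem eq_of_isEigenvector (hmono : Monotone f) (hhom : IsHomogeneous f) {x : Fin n → ℝ} {p : ℕ}
    (hp : 0 < p) (hx : f^[p] x = x) {v : Fin n → ℝ} (hv : IsEigenvector f v) : f v = v := by
  obtain ⟨a, ha⟩ := hv
  rcases isEmpty_or_nonempty (Fin n) with _ | _
  · exact Subsingleton.elim _ _
  have hiter := iterate_eigenvector hhom ha p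
  obtain ⟨i, hi⟩ := Finite.exists_max fun i => v i - x i
  obtain ⟨k, hk⟩ := Finite.exists_min fun i => v i - x i
  have h₁ : f^[p] v ≤ f^[p] fun j => (v i - x i) + x j :=
    hmono.iterate p fun j => by linarith [hi j]
  have h₂ : (f^[p] fun j => (v k - x k) + x j) ≤ f^[p] v :=
    hmono.iterate p fun j => by linarith [hk j]
  rw [iterate_add_const hhom, hx, hiter] at h₁ h₂
  have h₁' : p * a + v i ≤ (v i - x i) + x i := h₁ i
  have h₂' : (v k - x k) + x k ≤ p * a + v k := h₂ k
  have hpa : (p : ℝ) * a = 0 := le_antisymm (by linarith) (by linarith)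
  have ha0 : a = 0 := (mul_eq_zero.1 hpa).resolve_left (by positivity)
  rw [ha, ha0]
  simp

/-- A monotone homogeneous convex map with a periodic point has a fixed point. -/
theorem exists_fixedPoint (hconv : IsConvexMap f) (hmono : Monotone f) (hhom : IsHomogeneous f)
    {x : Fin n → ℝ} {p : ℕ} (hp : 0 < p) (hx : f^[p] x = x) : ∃ v, f v = v := by
  have hcont : Continuous f := continuous_pi fun i => (hconv i).locallyLipschitz.continuous
  have hper : Function.Periodic (fun t => f^[t] x) p := fun t => by
    simp only [Function.iterate_add_apply, hx]
  have hfin := finite_range_of_periodic hp hper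
  have hbdd (y) (hy : y ∈ Set.range fun t => f^[t] x) : y ≤ sSup (Set.range fun t => f^[t] x) :=
    le_csSup hfin.bddAbove hy
  set s := sSup (Set.range fun t => f^[t] x)
  have hle : s ≤ f s := by
    refine csSup_le (Set.range_nonempty _) ?_
    rintro _ ⟨t, rfl⟩
    -- Each orbit point is the image of an orbit point, so the supremum `s` satisfies `s ≤ f s` and
    -- its iterates increase.
    have h : f^[t] x = f (f^[t + p - 1] x) := by
      rw [← Function.iterate_succ_apply' f, Nat.succ_eq_add_one, Nat.sub_add_cancel (by omega)]
      exact (hper t).symm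
    simp only
    rw [h]
    exact hmono (hbdd _ ⟨_, rfl⟩)
  have hmon : Monotone fun t => f^[t] s := hmono.monotone_iterate_of_le_map hle
  obtain ⟨M, hM⟩ : ∃ M : ℝ, ∀ i, s i - x i ≤ M := by
    obtain ⟨M, hM⟩ := (Set.finite_range fun i => s i - x i).bddAbove
    exact ⟨M, fun i => hM ⟨i, rfl⟩⟩
  have hub : ∀ t i, f^[t] s i ≤ M + s i := fun t i => by
    have h : f^[t] s ≤ f^[t] fun j => M + x j := hmono.iterate t fun j => by linarith [hM j]
    rw [iterate_add_const hhom] at h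
    have h' := h i
    have h'' := hbdd _ ⟨t, rfl⟩ i
    simp only at h' h''
    linarith
  have hlim : Filter.Tendsto (fun t => f^[t] s) Filter.atTop
      (nhds fun i => ⨆ t, f^[t] s i) := by
    refine tendsto_pi_nhds.2 fun i => tendsto_atTop_ciSup (fun t t' h => hmon h i) ?_
    exact ⟨M + s i, by rintro _ ⟨t, rfl⟩; exact hub t i⟩
  exact ⟨_, isFixedPt_of_tendsto_iterate hlim hcont.continuousAt⟩

/-- The cyclicity of the critical graph is a period, on the critical nodes, of every backward
periodic orbit. -/
theorem periodic_cyclicity_of_mem_nodes (hmono : Monotone f) (hhom : IsHomogeneous f)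
    {v : Fin n → ℝ} (hv : f v = v) {b : ℕ → Fin n → ℝ} (hb : ∀ t, f (b (t + 1)) = b t) {p : ℕ}
    (hp : 0 < p) (hper : Function.Periodic b p) {i : Fin n}
    (hi : i ∈ (criticalGraph f v).nodes) :
    Function.Periodic (fun t => b t i) (criticalGraph f v).cyclicity := by
  set G := criticalGraph f v with hG
  have harc {i j} (h : G.Arc i j) (t : ℕ) : b t i - v i = b (t + 1) j - v j :=
    eq_of_criticalGraph_arc hmono hhom hv hb hp hper h t
  have hacc {i j} (h : G.HasAccess i j) : ∃ l, ∀ t, b t i - v i = b (t + l) j - v j := by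
    induction h with
    | refl => exact ⟨0, fun t => rfl⟩
    | tail _ h ih =>
      obtain ⟨l, hl⟩ := ih
      exact ⟨l + 1, fun t => (hl t).trans (harc h _)⟩
  -- Periods of a sequence are its periods under the shift, so its minimal period divides every
  -- circuit length, hence their gcd.
  set σ : (ℕ → ℝ) → (ℕ → ℝ) := fun u t => u (t + 1) with hσ
  have hiter (u : ℕ → ℝ) (m t : ℕ) : σ^[m] u t = u (t + m) := by
    induction m generalizing u with
    | zero => rfl
    | succ m ih =>
      rw [Function.iterate_succ_apply, ih]
      simp only [hσ, add_assoc]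
  have hσper (u : ℕ → ℝ) (m : ℕ) : Function.IsPeriodicPt σ m u ↔ Function.Periodic u m := by
    rw [Function.IsPeriodicPt, Function.IsFixedPt, funext_iff]
    simp only [hiter, Function.Periodic]
  set C : Set (Fin n) := {j | j ∈ G.nodes ∧ G.HasAccess i j ∧ G.HasAccess j i} with hC
  have hCclass : G.IsClass C := ⟨i, hi, rfl⟩
  rw [← hσper]
  refine (Function.isPeriodicPt_minimalPeriod σ _).trans_dvd (dvd_trans ?_ (Finset.dvd_lcm
    ((Set.Finite.mem_toFinset _).2 hCclass)))
  refine Nat.dvd_setGcd_iff.2 ?_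
  rintro k ⟨hk, q, hq, hqk⟩
  refine Function.IsPeriodicPt.minimalPeriod_dvd ((hσper _ _).2 fun t => ?_)
  have hwalk (m : ℕ) (hm : m ≤ k) (t : ℕ) :
      b t (q 0) - v (q 0) = b (t + m) (q m) - v (q m) := by
    induction m with
    | zero => rfl
    | succ m ih => exact (ih (by omega)).trans (harc (hq m (by omega)).1 _)
  have hq0 : q 0 ∈ C := (hq 0 hk).2.1
  obtain ⟨l, hl⟩ := hacc hq0.2.2
  have h₁ := hwalk k le_rfl
  rw [hqk] at h₁
  -- Adding periods makes room to go back `l` steps in time, from `i` to the start of the circuit.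
  obtain ⟨r, hr⟩ : ∃ r, t + r * p ≥ l := ⟨l, by nlinarith⟩
  have h₂ := hl (t + r * p - l)
  have h₃ := hl (t + r * p - l + k)
  have h₄ := h₁ (t + r * p - l)
  rw [add_right_comm] at h₃
  rw [Nat.sub_add_cancel hr] at h₂ h₃
  have h₅ : b (t + r * p) = b t := hper.nat_mul r t
  have h₆ : b (t + r * p + k) = b (t + k) := by
    rw [add_right_comm]; exact hper.nat_mul r (t + k)
  rw [h₅] at h₂
  rw [h₆] at h₃
  change b (t + k) i = b t i
  linarith

end Orbits

end ConvexSpectral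

/-! ### The orbit length divides the cyclicity -/

theorem theorem5p6 {n : ℕ} (f : (Fin n → ℝ) → (Fin n → ℝ))
    (hconv : ConvexSpectral.IsConvexMap f) (hmono : Monotone f)
    (hhom : ConvexSpectral.IsHomogeneous f)
    (x : Fin n → ℝ) (hx : x ∈ Function.periodicPts f) :
    (∃ v, ConvexSpectral.IsEigenvector f v) ∧
      ∀ v, ConvexSpectral.IsEigenvector f v →
        Function.minimalPeriod f x ∣ (ConvexSpectral.criticalGraph f v).cyclicity := by
  open ConvexSpectral in
  obtain ⟨p, hp, hxp⟩ := hx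
  have hxp' : f^[p] x = x := hxp
  refine ⟨?_, fun v hv => ?_⟩
  · obtain ⟨v, hv⟩ := exists_fixedPoint hconv hmono hhom hp hxp'
    exact ⟨v, 0, by simpa using hv⟩
  replace hv := eq_of_isEigenvector hmono hhom hp hxp' hv
  set m := (criticalGraph f v).cyclicity with hm
  -- On the orbit, `f^[p - 1]` is the inverse of `f`.
  let b : ℕ → Fin n → ℝ := fun t => f^[(p - 1) * t] x
  have hfix (t s : ℕ) : f^[t + p * s] x = f^[t] x := by
    rw [Function.iterate_add_apply, (hxp.mul_const s : f^[p * s] x = x)]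
  have hb (t) : f (b (t + 1)) = b t := by
    simp only [b]
    rw [← Function.iterate_succ_apply' f, ← hfix ((p - 1) * t) 1]
    congr 2
    rw [mul_add, Nat.succ_eq_add_one]
    omega
  have hper : Function.Periodic b p := fun t => by
    simp only [b]
    rw [mul_add, mul_comm (p - 1) p, hfix]
  have hbm (t) : f^[m] (b (t + m)) = b t := by
    induction m generalizing t with
    | zero => rfl
    | succ m ih => rw [Function.iterate_succ_apply, ← add_assoc, hb, ih]
  have hc (t) : f (b (t + 1 + m)) = b (t + m) := by rw [add_right_comm, hb]
  have hbfin := finite_range_of_periodic hp hper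
  have hcfin : (Set.range fun t => b (t + m)).Finite :=
    hbfin.subset (by rintro _ ⟨t, rfl⟩; exact ⟨_, rfl⟩)
  have heq (i) (hi : i ∈ (criticalGraph f v).nodes) (t) : b t i = b (t + m) i :=
    (periodic_cyclicity_of_mem_nodes hmono hhom hv hb hp hper hi t).symm
  have h0 : b m = b 0 := by
    refine le_antisymm ?_ ?_
    · simpa using le_of_eq_on_criticalGraph_nodes hconv hmono hhom hv hc hb hcfin hbfin
        (fun i hi t => (heq i hi t).symm) 0
    · simpa using le_of_eq_on_criticalGraph_nodes hconv hmono hhom hv hb hc hbfin hcfin heq 0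
  refine Function.IsPeriodicPt.minimalPeriod_dvd ?_
  have := hbm 0
  rw [zero_add, h0] at this
  have hfin : f^[m] x = x := by simpa [b] using this
  exact hfin
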